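/- Throughout, functions are measurable scalar-valued (real or complex) functions on $(0,\infty)$ with Lebesgue measure $|\cdot|$, identified when equal almost everywhere. For such $f$ let $\lambda_f(s)=|\{x>0:|f(x)|>s\}|$ and $f^*(t)=\inf\{s\ge 0:\lambda_f(s)\le t\}$ for $t\ge 0$, and let $Sf(t)=\frac1t\int_0^t f(r)\,dr$ be the Hardy operator. Let $L^{1,\infty}=\{f:\sup_{t>0}tf^*(t)<\infty\}$. An r.i. quasi-Banach space is a vector space $X$ of such functions with a complete quasi-norm $\|\cdot\|_X$ such that $X$ contains the indicator functions of all sets of finite measure; $g\in X$ and $|f|\le|g|$ a.e. imply $f\in X$ and $\|f\|_X\le\|g\|_X$; and $g\in X$ and $\lambda_f=\lambda_g$ imply $f\in X$ and $\|f\|_X=\|g\|_X$. Let $\varphi:[0,\infty)\to[0,\infty)$ be quasi-concave, that is, $\varphi$ is increasing, $\varphi(t)=0$ if and only if $t=0$, and $t\mapsto\varphi(t)/t$ is decreasing on $(0,\infty)$ (in the wide sense). Let $\Lambda_\varphi=\{f:\|f\|_{\Lambda_\varphi}=\int_{[0,\infty)}f^*\,d\varphi<\infty\}$, where $d\varphi$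 is the Lebesgue–Stieltjes measure of $\varphi$, with mass $\varphi(0^+)$ at the origin. **Theorem 3.2.** Let $\varphi$ be quasi-concave. Then the optimal range $\mathfrak R_q[S,\Lambda_\varphi]$, that is, the smallest (with respect to continuous inclusion) r.i. quasi-Banach space $X$ such that $S:\Lambda_\varphi\to X$ is well defined and bounded, exists, and it coincides, with equivalent quasi-norms, with the space $$Y=\{f\in L^{1,\infty}+L^\infty:\ f^*\le S(g^*)\text{ on }(0,\infty)\text{ for some }g\in\Lambda_\varphi\},$$ endowed with $$\|f\|_Y=\inf\{\|g\|_{\Lambda_\varphi}:\ g\in\Lambda_\varphi,\ f^*\le S(g^*)\}.$$ In particular, $Y$ is an r.i. quasi-Banach space: $\|\cdot\|_Y$ is a rearrangement invariant quasi-norm and $Y$ is complete; $S:\Lambda_\varphi\to Y$ is bounded; and $Y\subset X$ continuously for every r.i. quasi-Banach space $X$ such that $S:\Lambda_\varphi\to X$ is bounded. -/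

import Mathlib

open MeasureTheory Set Filter Topology
open scoped ENNReal

noncomputable section

namespace HardyRange

/-- Lebesgue measure on `(0, ∞)`. Functions on `(0, ∞)` are represented by functions on `ℝ`,
considered up to equality almost everywhere for this measure. -/
def posVol : Measure ℝ := volume.restrict (Ioi 0)

/-- Quasi-concave functions on `[0, ∞)`: `φ` is (non-strictly) increasing, vanishes exactly at the
origin, and `φ(t)/t` is (non-strictly) decreasing on `(0, ∞)`. A jump at the origin is allowed. -/
structure IsQuasiConcave (φ : ℝ → ℝ) : Prop where
  monotoneOn : MonotoneOn φ (Ici 0)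
  eq_zero_iff : ∀ t : ℝ, 0 ≤ t → (φ t = 0 ↔ t = 0)
  antitoneOn_div : AntitoneOn (fun t => φ t / t) (Ioi 0)

/-- The extension of `φ` by `φ 0 = 0` to the negative half-line is monotone. -/
theorem IsQuasiConcave.monotone_ext {φ : ℝ → ℝ} (hφ : IsQuasiConcave φ) :
    Monotone (fun t : ℝ => φ (max t 0)) := fun _ _ hab =>
  hφ.monotoneOn (mem_Ici.2 (le_max_right _ _)) (mem_Ici.2 (le_max_right _ _))
    (max_le_max_right 0 hab)

/-- The Lebesgue-Stieltjes measure `dφ` on `[0, ∞)`; it has the mass `φ(0+)` at the origin. -/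
def stieltjes {φ : ℝ → ℝ} (hφ : IsQuasiConcave φ) : Measure ℝ :=
  hφ.monotone_ext.stieltjesFunction.measure

section Spaces

variable {𝕜 : Type*} [RCLike 𝕜]

/-- The distribution function `λ_f(s) = |{x > 0 : |f(x)| > s}|`. -/
def distrib (f : ℝ → 𝕜) (s : ℝ≥0∞) : ℝ≥0∞ := posVol {x | s < ‖f x‖ₑ}

/-- The decreasing rearrangement `f*(t) = inf {s : λ_f(s) ≤ t}`; `f*(0)` is the essential
supremum of `|f|`. -/
def rearr (f : ℝ → 𝕜) (t : ℝ) : ℝ≥0∞ := sInf {s : ℝ≥0∞ | distrib f s ≤ ENNReal.ofReal t}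

/-- `‖f‖_{Λ_φ} = ∫_{[0, ∞)} f* dφ`. -/
def lorentzNorm {φ : ℝ → ℝ} (hφ : IsQuasiConcave φ) (f : ℝ → 𝕜) : ℝ≥0∞ :=
  ∫⁻ t, rearr f t ∂(stieltjes hφ)

variable (𝕜) in
/-- The minimal Lorentz space `Λ_φ`. -/
def lorentz {φ : ℝ → ℝ} (hφ : IsQuasiConcave φ) : Set (ℝ → 𝕜) :=
  {f | AEStronglyMeasurable f posVol ∧ lorentzNorm hφ f < ∞}

/-- The Hardy operator `Sf(t) = (1/t) ∫_0^t f(r) dr`. -/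
def hardy (f : ℝ → 𝕜) (t : ℝ) : 𝕜 := t⁻¹ • ∫ r in Ioc 0 t, f r

/-- The Hardy operator on functions with values in `[0, ∞]`, such as rearrangements. -/
def hardyPos (h : ℝ → ℝ≥0∞) (t : ℝ) : ℝ≥0∞ := (ENNReal.ofReal t)⁻¹ * ∫⁻ r in Ioc 0 t, h r

/-- Membership in weak `L¹`: `sup_{t > 0} t f*(t) < ∞`. -/
def MemWeakL1 (f : ℝ → 𝕜) : Prop :=
  AEStronglyMeasurable f posVol ∧
    ∃ C : ℝ≥0∞, C ≠ ∞ ∧ ∀ t : ℝ, 0 < t → ENNReal.ofReal t * rearr f t ≤ C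

/-- Membership in `L^{1,∞} + L^∞`. -/
def MemWeakL1AddLinfty (f : ℝ → 𝕜) : Prop :=
  ∃ f₁ f₂ : ℝ → 𝕜, MemWeakL1 f₁ ∧ MemLp f₂ ∞ posVol ∧ f =ᵐ[posVol] f₁ + f₂

/-- `X`, with the quasi-norm `N` (whose values outside `X` are irrelevant), is a rearrangement
invariant quasi-Banach function space on `(0, ∞)`. -/
structure IsRIQuasiBanach (X : Set (ℝ → 𝕜)) (N : (ℝ → 𝕜) → ℝ≥0∞) : Prop where
  aestronglyMeasurable : ∀ f ∈ X, AEStronglyMeasurable f posVol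
  lt_top : ∀ f ∈ X, N f < ∞
  eq_zero_iff : ∀ f ∈ X, (N f = 0 ↔ f =ᵐ[posVol] 0)
  smul : ∀ (c : 𝕜), ∀ f ∈ X, c • f ∈ X ∧ N (c • f) = ‖c‖ₑ * N f
  add : ∃ C : ℝ≥0∞, C ≠ ∞ ∧ ∀ f ∈ X, ∀ g ∈ X, f + g ∈ X ∧ N (f + g) ≤ C * (N f + N g)
  ideal : ∀ g ∈ X, ∀ f : ℝ → 𝕜, AEStronglyMeasurable f posVol →
    (∀ᵐ x ∂posVol, ‖f x‖ ≤ ‖g x‖) → f ∈ X ∧ N f ≤ N g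
  rearrangementInvariant : ∀ g ∈ X, ∀ f : ℝ → 𝕜, AEStronglyMeasurable f posVol →
    (∀ s, distrib f s = distrib g s) → f ∈ X ∧ N f = N g
  indicator_mem : ∀ A : Set ℝ, MeasurableSet A → posVol A < ∞ →
    A.indicator (fun _ => (1 : 𝕜)) ∈ X
  complete : ∀ u : ℕ → ℝ → 𝕜, (∀ n, u n ∈ X) →
    (∀ ε : ℝ≥0∞, 0 < ε → ∃ n₀, ∀ m ≥ n₀, ∀ n ≥ n₀, N (u m - u n) ≤ ε) →
    ∃ f ∈ X, Tendsto (fun n => N (u n - f)) atTop (𝓝 0)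

/-- `S : Λ_φ → X` is (well defined and) bounded. -/
def HardyBounded {φ : ℝ → ℝ} (hφ : IsQuasiConcave φ)
    (X : Set (ℝ → 𝕜)) (N : (ℝ → 𝕜) → ℝ≥0∞) : Prop :=
  (∀ g ∈ lorentz 𝕜 hφ, ∀ t : ℝ, 0 < t → IntegrableOn g (Ioc 0 t)) ∧
  ∃ C : ℝ≥0∞, C ≠ ∞ ∧ ∀ g ∈ lorentz 𝕜 hφ, hardy g ∈ X ∧ N (hardy g) ≤ C * lorentzNorm hφ g

/-- The continuous inclusion `X ⊂ X'`. -/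
def Embeds (X : Set (ℝ → 𝕜)) (N : (ℝ → 𝕜) → ℝ≥0∞)
    (X' : Set (ℝ → 𝕜)) (N' : (ℝ → 𝕜) → ℝ≥0∞) : Prop :=
  X ⊆ X' ∧ ∃ C : ℝ≥0∞, C ≠ ∞ ∧ ∀ f ∈ X, N' f ≤ C * N f

/-- `X` is an optimal range of the Hardy operator on `Λ_φ`: it is the smallest r.i. quasi-Banach
space into which `S` maps `Λ_φ` boundedly. -/
def IsOptimalRange {φ : ℝ → ℝ} (hφ : IsQuasiConcave φ)
    (X : Set (ℝ → 𝕜)) (N : (ℝ → 𝕜) → ℝ≥0∞) : Prop :=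
  IsRIQuasiBanach X N ∧ HardyBounded hφ X N ∧
    ∀ (X' : Set (ℝ → 𝕜)) (N' : (ℝ → 𝕜) → ℝ≥0∞),
      IsRIQuasiBanach X' N' → HardyBounded hφ X' N' → Embeds X N X' N'

/-- The functions `g ∈ Λ_φ` with `f* ≤ S(g*)` on `(0, ∞)`. -/
def majorants {φ : ℝ → ℝ} (hφ : IsQuasiConcave φ) (f : ℝ → 𝕜) : Set (ℝ → 𝕜) :=
  {g | g ∈ lorentz 𝕜 hφ ∧ ∀ t : ℝ, 0 < t → rearr f t ≤ hardyPos (rearr g) t}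

variable (𝕜) in
/-- The space `Y` of all `f ∈ L^{1,∞} + L^∞` with `f* ≤ S(g*)` for some `g ∈ Λ_φ`. -/
def rangeSpace {φ : ℝ → ℝ} (hφ : IsQuasiConcave φ) : Set (ℝ → 𝕜) :=
  {f | MemWeakL1AddLinfty f ∧ ∃ g : ℝ → 𝕜, g ∈ majorants hφ f}

/-- `‖f‖_Y = inf {‖g‖_{Λ_φ} : f* ≤ S(g*)}`. -/
def rangeNorm {φ : ℝ → ℝ} (hφ : IsQuasiConcave φ) (f : ℝ → 𝕜) : ℝ≥0∞ :=
  ⨅ g ∈ majorants hφ f, lorentzNorm hφ g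

end Spaces

end HardyRange

end

open HardyRange

/-! The rearrangement of `Sg` is at most `S(g*)`, so `S` maps `Λ_φ` into `Y` with constant 1.
Conversely, if `S` maps `Λ_φ` into `X` and `f* ≤ S(g*)`, then `S(g*)` lies in `X`, hence so does
`f*` by the ideal property, and `f` by rearrangement invariance (`rangeSpace_embeds`). The remaining
task is to show that `Y` is a complete r.i. space.

Two estimates carry it. Both reduce by layer cake to initial segments, where `dφ` of `[0, b)` is
`φ(b)`, and then to quasi-concavity of `φ`. Dilation by `a ≤ 1` costs at most the factor `1/a` in
`Λ_φ` (`lintegral_rearr_comp_mul_le`), and `S(g*) ≤ ‖g‖/φ` pointwise (`hardyPos_rearr_le`), which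
supplies finiteness and definiteness.

Since `(∑ f_k)*(t) ≤ ∑ f_k*(t/2^(k+1))` and `S` commutes with dilations, `∑ g_k*(·/2^(k+1))` is a
majorant of `∑ f_k` whenever each `g_k` is one of `f_k`. The resulting countable quasi-triangle
inequality with weights `2^(k+1)` gives both the quasi-norm property and completeness. -/

namespace HardyRange

/-! ### Layer cake formula -/

/-- Realises any `d`, infinite or not, as the length of an initial interval, so that comparisons of
measures become inclusions. -/
theorem volume_pos_lt (d : ℝ≥0∞) : volume {x : ℝ | 0 < x ∧ ENNReal.ofReal x < d} = d := by
  rcases eq_or_ne d ∞ with rfl | hd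
  · have : {x : ℝ | 0 < x ∧ ENNReal.ofReal x < ∞} = Ioi 0 := by
      ext x; simp
    rw [this, Real.volume_Ioi]
  · have : {x : ℝ | 0 < x ∧ ENNReal.ofReal x < d} = Ioo 0 d.toReal := by
      ext x
      simp only [mem_ofPred_eq, mem_Ioo]
      refine and_congr_right fun hx => ?_
      exact ENNReal.ofReal_lt_iff_lt_toReal hx.le hd
    rw [this, Real.volume_Ioo, sub_zero, ENNReal.ofReal_toReal hd]

/-- The layer cake formula for functions with values in `[0, ∞]`. -/
theorem lintegral_eq_lintegral_superlevel {α : Type*} [MeasurableSpace α] (μ : Measure α)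
    [SFinite μ] {h : α → ℝ≥0∞} (hh : AEMeasurable h μ) :
    ∫⁻ x, h x ∂μ = ∫⁻ s in Ioi (0 : ℝ), μ {x | ENNReal.ofReal s < h x} := by
  have key : ∀ h : α → ℝ≥0∞, Measurable h →
      ∫⁻ x, h x ∂μ = ∫⁻ s in Ioi (0 : ℝ), μ {x | ENNReal.ofReal s < h x} := by
    intro h hh
    have hmeas : MeasurableSet {p : α × ℝ | ENNReal.ofReal p.2 < h p.1} :=
      measurableSet_lt (ENNReal.measurable_ofReal.comp measurable_snd) (hh.comp measurable_fst)
    have h1 : ∀ x, h x = ∫⁻ s in Ioi (0 : ℝ),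
        {p : α × ℝ | ENNReal.ofReal p.2 < h p.1}.indicator 1 (x, s) := by
      intro x
      have hm : MeasurableSet {s : ℝ | ENNReal.ofReal s < h x} :=
        measurableSet_lt ENNReal.measurable_ofReal measurable_const
      have : (fun s : ℝ => {p : α × ℝ | ENNReal.ofReal p.2 < h p.1}.indicator
          (1 : α × ℝ → ℝ≥0∞) (x, s)) = {s : ℝ | ENNReal.ofReal s < h x}.indicator 1 := by
        ext s; simp [indicator]
      rw [this, lintegral_indicator_one hm, Measure.restrict_apply hm]
      conv_lhs => rw [← volume_pos_lt (h x)]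
      congr 1
      ext s
      simp [and_comm]
    rw [lintegral_congr h1, lintegral_lintegral_swap
      (f := fun x s => {p : α × ℝ | ENNReal.ofReal p.2 < h p.1}.indicator 1 (x, s))
      (measurable_one.indicator hmeas).aemeasurable]
    refine lintegral_congr fun s => ?_
    have hm : MeasurableSet {x | ENNReal.ofReal s < h x} := measurableSet_lt measurable_const hh
    rw [← lintegral_indicator_one hm]
    refine lintegral_congr fun x => ?_
    simp [indicator]
  rw [lintegral_congr_ae hh.ae_eq_mk, key _ hh.measurable_mk]
  refine lintegral_congr fun s => measure_congr ?_
  filter_upwards [hh.ae_eq_mk] with x hx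
  exact congrArg (fun y => ENNReal.ofReal s < y) hx.symm

instance : SFinite posVol := by unfold posVol; infer_instance

instance {φ : ℝ → ℝ} (hφ : IsQuasiConcave φ) : SFinite (stieltjes hφ) := by
  unfold stieltjes; infer_instance

/-! ### Distribution functions and decreasing rearrangements -/

section Rearrangement

variable {𝕜 : Type*} [RCLike 𝕜]

/-- The infimum is attained: superlevel sets increase to `{s < |f|}` as the level decreases to `s`.
This Galois connection replaces direct work with the infimum. -/
theorem rearr_le_iff (f : ℝ → 𝕜) (t : ℝ) (s : ℝ≥0∞) :
    rearr f t ≤ s ↔ distrib f s ≤ ENNReal.ofReal t := by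
  refine ⟨fun h => ?_, fun h => sInf_le h⟩
  rcases eq_or_ne s ∞ with rfl | hs
  · simp [distrib]
  have hmono : ∀ s', s < s' → distrib f s' ≤ ENNReal.ofReal t := by
    intro s' hs'
    obtain ⟨r, hr, hr'⟩ := sInf_lt_iff.1 (h.trans_lt hs')
    exact (measure_mono fun x (hx : s' < _) => hr'.trans hx).trans hr
  obtain ⟨u, hu, hus, hlim⟩ := exists_seq_strictAnti_tendsto' (hs.lt_top)
  have hU : {x | s < ‖f x‖ₑ} = ⋃ n, {x | u n < ‖f x‖ₑ} := by
    ext x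
    simp only [mem_ofPred_eq, mem_iUnion]
    refine ⟨fun hx => ?_, fun ⟨n, hn⟩ => (hus n).1.trans hn⟩
    exact (hlim.eventually_lt_const hx).exists
  have hM : Monotone fun n => {x | u n < ‖f x‖ₑ} :=
    fun m n hmn x (hx : u m < _) => (hu.antitone hmn).trans_lt hx
  rw [distrib, hU, hM.measure_iUnion]
  exact iSup_le fun n => hmono _ (hus n).1

theorem lt_rearr_iff (f : ℝ → 𝕜) (t : ℝ) (s : ℝ≥0∞) :
    s < rearr f t ↔ ENNReal.ofReal t < distrib f s := by
  simpa using (rearr_le_iff f t s).not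

theorem antitone_rearr (f : ℝ → 𝕜) : Antitone (rearr f) := fun _ _ hab =>
  (rearr_le_iff _ _ _).2 (((rearr_le_iff _ _ _).1 le_rfl).trans (ENNReal.ofReal_le_ofReal hab))

theorem rearr_le_rearr {f g : ℝ → 𝕜} (h : ∀ s, distrib f s ≤ distrib g s) (t : ℝ) :
    rearr f t ≤ rearr g t :=
  (rearr_le_iff _ _ _).2 ((h _).trans ((rearr_le_iff _ _ _).1 le_rfl))

theorem distrib_mono_ae {f g : ℝ → 𝕜} (h : ∀ᵐ x ∂posVol, ‖f x‖ ≤ ‖g x‖) (s : ℝ≥0∞) :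
    distrib f s ≤ distrib g s := by
  refine measure_mono_ae ?_
  filter_upwards [h] with x hx (hs : s < _)
  exact hs.trans_le (enorm_le_iff_norm_le.2 hx)

theorem rearr_le_of_ae {f : ℝ → 𝕜} {t : ℝ} {s : ℝ≥0∞}
    (h : ∀ x, 0 < x → t ≤ x → ‖f x‖ₑ ≤ s) : rearr f t ≤ s := by
  rw [rearr_le_iff, distrib, posVol, Measure.restrict_apply₀' measurableSet_Ioi.nullMeasurableSet]
  refine (measure_mono (t := Ioo 0 t) ?_).trans (by simp)
  rintro x ⟨hx, hx0⟩
  exact ⟨hx0, lt_of_not_ge fun htx => (h x hx0 htx).not_gt hx⟩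

theorem rearr_smul (c : 𝕜) (f : ℝ → 𝕜) (t : ℝ) : rearr (c • f) t = ‖c‖ₑ * rearr f t := by
  have key : ∀ (c : 𝕜) (f : ℝ → 𝕜), rearr (c • f) t ≤ ‖c‖ₑ * rearr f t := by
    intro c f
    rw [rearr_le_iff]
    refine (measure_mono ?_).trans ((rearr_le_iff f t _).1 le_rfl)
    intro x hx
    simp only [mem_ofPred_eq, Pi.smul_apply, enorm_smul] at hx ⊢
    exact lt_of_not_ge fun h => hx.not_ge (mul_le_mul_right h _)
  rcases eq_or_ne c 0 with rfl | hc
  · simpa using key 0 f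
  refine le_antisymm (key c f) ?_
  have h := key c⁻¹ (c • f)
  rw [inv_smul_smul₀ hc, enorm_inv hc] at h
  calc ‖c‖ₑ * rearr f t ≤ ‖c‖ₑ * (‖c‖ₑ⁻¹ * rearr (c • f) t) := mul_le_mul_right h _
    _ = rearr (c • f) t := by
      rw [← mul_assoc, ENNReal.mul_inv_cancel (by simpa using hc) (by simp), one_mul]

theorem distrib_zero_eq_zero_iff (f : ℝ → 𝕜) : distrib f 0 = 0 ↔ f =ᵐ[posVol] 0 := by
  rw [distrib, Filter.EventuallyEq, ae_iff]
  simp [pos_iff_ne_zero]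

theorem ae_eq_zero_of_rearr {f : ℝ → 𝕜} (h : ∀ t, 0 < t → rearr f t = 0) : f =ᵐ[posVol] 0 := by
  rw [← distrib_zero_eq_zero_iff, ← nonpos_iff_eq_zero]
  refine ENNReal.le_of_forall_pos_le_add fun ε hε _ => ?_
  have := (rearr_le_iff f ε 0).1 (h ε (by exact_mod_cast hε)).le
  simpa using this

theorem rearr_eq_zero_of_ae {f : ℝ → 𝕜} (h : f =ᵐ[posVol] 0) (t : ℝ) : rearr f t = 0 := by
  rw [← nonpos_iff_eq_zero, rearr_le_iff, (distrib_zero_eq_zero_iff f).2 h]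
  exact zero_le

/-- If a sum exceeds the sum of the thresholds, some term exceeds its own threshold; the `k`-th such
set has measure at most `t/2^(k+1)`, and these add up to `t`. -/
theorem posVol_tsum_rearr_lt_le (f : ℕ → ℝ → 𝕜) (t : ℝ) :
    posVol {x | ∑' k, rearr (f k) ((2 ^ (k + 1))⁻¹ * t) < ∑' k, ‖f k x‖ₑ} ≤ ENNReal.ofReal t := by
  calc posVol {x | ∑' k, rearr (f k) ((2 ^ (k + 1))⁻¹ * t) < ∑' k, ‖f k x‖ₑ}
      ≤ ∑' k, distrib (f k) (rearr (f k) ((2 ^ (k + 1))⁻¹ * t)) := by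
        refine le_trans (measure_mono fun x hx => mem_iUnion.2 ?_) (measure_iUnion_le _)
        by_contra! hc
        exact lt_irrefl _
          (lt_of_lt_of_le hx (ENNReal.tsum_le_tsum fun k => not_lt.1 (hc k)))
    _ ≤ ∑' k : ℕ, ENNReal.ofReal ((2 ^ (k + 1))⁻¹ * t) :=
        ENNReal.tsum_le_tsum fun k => (rearr_le_iff _ _ _).1 le_rfl
    _ = ∑' k : ℕ, 2⁻¹ ^ (k + 1) * ENNReal.ofReal t := by
        refine tsum_congr fun k => ?_
        rw [ENNReal.ofReal_mul (by positivity), ENNReal.ofReal_inv_of_pos (by positivity),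
          ENNReal.ofReal_pow (by norm_num), ENNReal.inv_pow]
        simp
    _ = ENNReal.ofReal t := by
        rw [ENNReal.tsum_mul_right, ENNReal.tsum_geometric_add_one]
        simp [ENNReal.inv_mul_cancel]

theorem rearr_le_tsum_rearr {F : ℝ → 𝕜} {f : ℕ → ℝ → 𝕜}
    (hF : ∀ᵐ x ∂posVol, ‖F x‖ₑ ≤ ∑' k, ‖f k x‖ₑ) (t : ℝ) :
    rearr F t ≤ ∑' k, rearr (f k) ((2 ^ (k + 1))⁻¹ * t) := by
  rw [rearr_le_iff]
  refine (measure_mono_ae ?_).trans (posVol_tsum_rearr_lt_le f t)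
  filter_upwards [hF] with x hx hs
  exact lt_of_lt_of_le hs hx

/-- The scalar function with values `h x`, where `h x = ∞` is replaced by `0`. -/
noncomputable def toScalar (𝕜 : Type*) [RCLike 𝕜] (h : ℝ → ℝ≥0∞) (x : ℝ) : 𝕜 :=
  ((h x).toReal : 𝕜)

theorem enorm_toScalar {h : ℝ → ℝ≥0∞} {x : ℝ} (hx : h x ≠ ∞) : ‖toScalar 𝕜 h x‖ₑ = h x := by
  rw [toScalar, ← ofReal_norm, RCLike.norm_ofReal, abs_of_nonneg ENNReal.toReal_nonneg,
    ENNReal.ofReal_toReal hx]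

theorem enorm_toScalar_le (h : ℝ → ℝ≥0∞) (x : ℝ) : ‖toScalar 𝕜 h x‖ₑ ≤ h x := by
  rcases eq_or_ne (h x) ∞ with hx | hx
  · simp [hx]
  · exact (enorm_toScalar hx).le

theorem measurable_toScalar {h : ℝ → ℝ≥0∞} (hh : Measurable h) : Measurable (toScalar 𝕜 h) :=
  RCLike.measurable_ofReal.comp hh.ennreal_toReal

theorem rearr_toScalar_le {h : ℝ → ℝ≥0∞} (hh : Antitone h) (t : ℝ) :
    rearr (toScalar 𝕜 h) t ≤ h t :=
  rearr_le_of_ae fun x _ htx => (enorm_toScalar_le h x).trans (hh htx)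

/-- For `x > 0`, `s < f*(x)` means `x < λ_f(s)`, an interval of length `λ_f(s)`. Finiteness matters
because `toScalar` sends `∞` to `0`. -/
theorem distrib_toScalar_rearr {f : ℝ → 𝕜} (hf : ∀ t, 0 < t → rearr f t ≠ ∞) (s : ℝ≥0∞) :
    distrib (toScalar 𝕜 (rearr f)) s = distrib f s := by
  rw [distrib, posVol, Measure.restrict_apply₀' measurableSet_Ioi.nullMeasurableSet]
  conv_rhs => rw [← volume_pos_lt (distrib f s)]
  congr 1
  ext x
  simp only [mem_inter_iff, mem_ofPred_eq, mem_Ioi]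
  rw [and_comm]
  refine and_congr_right fun hx => ?_
  rw [enorm_toScalar (hf x hx), lt_rearr_iff]

end Rearrangement

/-! ### The Hardy operator on rearrangements -/

section Hardy

variable {𝕜 : Type*} [RCLike 𝕜]

/-- The Hardy-Littlewood inequality on an initial interval. -/
theorem lintegral_enorm_le_lintegral_rearr {g : ℝ → 𝕜} (hg : AEStronglyMeasurable g posVol)
    (t : ℝ) : ∫⁻ r in Ioc 0 t, ‖g r‖ₑ ≤ ∫⁻ r in Ioc 0 t, rearr g r := by
  have hsub : Ioc 0 t ⊆ Ioi (0 : ℝ) := fun x hx => hx.1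
  rw [lintegral_eq_lintegral_superlevel _ (antitone_rearr g).measurable.aemeasurable,
    lintegral_eq_lintegral_superlevel _
      (hg.mono_measure (Measure.restrict_mono hsub le_rfl)).enorm]
  refine lintegral_mono fun s => ?_
  simp only
  simp_rw [lt_rearr_iff]
  set d := distrib g (ENNReal.ofReal s) with hd
  -- Each level set meets `(0, t]` in measure at most `min t d`, which the level sets of `g*`
  -- attain.
  have h1 : volume.restrict (Ioc 0 t) {x | ENNReal.ofReal s < ‖g x‖ₑ} ≤ min (ENNReal.ofReal t) d :=
    le_min ((measure_mono (subset_univ _)).trans (by simp))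
      (Measure.restrict_mono hsub le_rfl _)
  refine h1.trans ?_
  rw [Measure.restrict_apply₀' measurableSet_Ioc.nullMeasurableSet,
    ← volume_pos_lt (min (ENNReal.ofReal t) d)]
  refine measure_mono fun x ⟨hx, hx'⟩ => ?_
  rw [lt_min_iff] at hx'
  exact ⟨hx'.2, hx, ((ENNReal.ofReal_lt_ofReal_iff_of_nonneg hx.le).1 hx'.1).le⟩

theorem hardyPos_comp_mul {h : ℝ → ℝ≥0∞} (hh : Measurable h) {a : ℝ} (ha : 0 < a) (t : ℝ) :
    hardyPos (fun x => h (a * x)) t = hardyPos h (a * t) := by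
  have hvol := Real.smul_map_volume_mul_left ha.ne'
  have h1 : ∫⁻ r in Ioc 0 (a * t), h r = ENNReal.ofReal a * ∫⁻ r in Ioc 0 t, h (a * r) := by
    conv_lhs => rw [← hvol]
    rw [Measure.restrict_smul, lintegral_smul_measure, abs_of_pos ha, smul_eq_mul,
      setLIntegral_map measurableSet_Ioc hh (measurable_const_mul a)]
    congr 3
    ext x
    simp only [mem_preimage, mem_Ioc]
    rw [mul_pos_iff_of_pos_left ha, mul_le_mul_iff_right₀ ha]
  rw [hardyPos, hardyPos, h1, ENNReal.ofReal_mul ha.le,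
    ENNReal.mul_inv (Or.inl (by simpa using ha)) (Or.inl (by simp))]
  rw [mul_mul_mul_comm, ENNReal.inv_mul_cancel (by simpa using ha) (by simp), one_mul]

theorem le_hardyPos {h : ℝ → ℝ≥0∞} (hh : Antitone h) {t : ℝ} (ht : 0 < t) :
    h t ≤ hardyPos h t := by
  have h1 : h t * ENNReal.ofReal t ≤ ∫⁻ r in Ioc 0 t, h r := by
    calc h t * ENNReal.ofReal t = ∫⁻ _ in Ioc 0 t, h t := by simp
      _ ≤ _ := setLIntegral_mono' measurableSet_Ioc fun x hx => hh hx.2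
  rw [hardyPos, ← ENNReal.div_eq_inv_mul]
  rwa [ENNReal.le_div_iff_mul_le (Or.inl (by simpa using ht)) (Or.inl (by simp))]

/-- The mean over `(0, b]` is the mean over `(0, a]` of the dilate by `b/a ≥ 1`, which is pointwise
smaller. -/
theorem hardyPos_antitoneOn {h : ℝ → ℝ≥0∞} (hh : Antitone h) :
    AntitoneOn (hardyPos h) (Ioi 0) := by
  intro a ha b hb hab
  have ha' : 0 < a := ha
  have hb' : 0 < b := hb
  have hc : 0 < b / a := by positivity
  have : hardyPos h b = hardyPos (fun x => h (b / a * x)) a := by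
    rw [hardyPos_comp_mul hh.measurable hc, div_mul_cancel₀ _ ha'.ne']
  rw [this, hardyPos, hardyPos]
  refine mul_le_mul_right (setLIntegral_mono' measurableSet_Ioc fun x hx => hh ?_) _
  have : 1 ≤ b / a := (one_le_div ha').2 hab
  nlinarith [hx.1]

theorem hardyPos_tsum {h : ℕ → ℝ → ℝ≥0∞} (hh : ∀ k, Measurable (h k)) (t : ℝ) :
    hardyPos (fun x => ∑' k, h k x) t = ∑' k, hardyPos (h k) t := by
  simp only [hardyPos]
  rw [lintegral_tsum fun k => (hh k).aemeasurable, ENNReal.tsum_mul_left]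

end Hardy

/-! ### Quasi-concavity, Lorentz norms and majorants -/

section Lorentz

variable {φ : ℝ → ℝ}

theorem IsQuasiConcave.pos (hφ : IsQuasiConcave φ) {t : ℝ} (ht : 0 < t) : 0 < φ t := by
  have h0 : φ 0 = 0 := (hφ.eq_zero_iff 0 le_rfl).2 rfl
  have h1 : φ 0 ≤ φ t := hφ.monotoneOn (mem_Ici.2 le_rfl) (mem_Ici.2 ht.le) ht.le
  exact lt_of_le_of_ne (h0 ▸ h1) fun h => ht.ne' ((hφ.eq_zero_iff t ht.le).1 h.symm)

theorem IsQuasiConcave.mul_le_mul (hφ : IsQuasiConcave φ) {s t : ℝ} (hs : 0 < s) (hst : s ≤ t) :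
    s * φ t ≤ t * φ s := by
  have h := hφ.antitoneOn_div (mem_Ioi.2 hs) (mem_Ioi.2 (hs.trans_le hst)) hst
  simp only at h
  rw [div_le_div_iff₀ (hs.trans_le hst) hs] at h
  linarith

/-- Quasi-concavity squeezes `φ x` between `φ a * min 1 (x / a)` and `φ a * max 1 (x / a)`. -/
theorem IsQuasiConcave.continuousAt (hφ : IsQuasiConcave φ) {a : ℝ} (ha : 0 < a) :
    ContinuousAt φ a := by
  have hlo : Tendsto (fun x => φ a * min 1 (x / a)) (𝓝 a) (𝓝 (φ a)) := by
    have : ContinuousAt (fun x => φ a * min 1 (x / a)) a := by fun_prop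
    simpa [ContinuousAt, ha.ne'] using this
  have hhi : Tendsto (fun x => φ a * max 1 (x / a)) (𝓝 a) (𝓝 (φ a)) := by
    have : ContinuousAt (fun x => φ a * max 1 (x / a)) a := by fun_prop
    simpa [ContinuousAt, ha.ne'] using this
  have hpos : ∀ᶠ x in 𝓝 a, 0 < x := lt_mem_nhds ha
  refine tendsto_of_tendsto_of_tendsto_of_le_of_le' hlo hhi ?_ ?_
  · filter_upwards [hpos] with x hx
    rcases le_total x a with h | h
    · refine (mul_le_mul_of_nonneg_left (min_le_right _ _) (hφ.pos ha).le).trans ?_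
      rw [mul_div_assoc', div_le_iff₀ ha]
      linarith [hφ.mul_le_mul hx h]
    · refine (mul_le_mul_of_nonneg_left (min_le_left _ _) (hφ.pos ha).le).trans ?_
      rw [mul_one]
      exact hφ.monotoneOn (mem_Ici.2 ha.le) (mem_Ici.2 hx.le) h
  · filter_upwards [hpos] with x hx
    rcases le_total x a with h | h
    · refine le_trans ?_ (mul_le_mul_of_nonneg_left (le_max_left _ _) (hφ.pos ha).le)
      rw [mul_one]
      exact hφ.monotoneOn (mem_Ici.2 hx.le) (mem_Ici.2 ha.le) h
    · refine le_trans ?_ (mul_le_mul_of_nonneg_left (le_max_right _ _) (hφ.pos ha).le)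
      rw [mul_div_assoc', le_div_iff₀ ha]
      linarith [hφ.mul_le_mul ha h]

/-- The extension vanishes on the negative axis, so the jump at the origin is counted; continuity at
`a` removes the one-sided limit. -/
theorem stieltjes_Iio (hφ : IsQuasiConcave φ) {a : ℝ} (ha : 0 < a) :
    stieltjes hφ (Iio a) = ENNReal.ofReal (φ a) := by
  have hψ : ∀ {x : ℝ}, 0 < x → ContinuousAt (fun t : ℝ => φ (max t 0)) x := by
    intro x hx
    refine (hφ.continuousAt hx).congr ?_
    filter_upwards [lt_mem_nhds hx] with y hy
    rw [max_eq_left hy.le]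
  have hpos : ∀ {x : ℝ}, 0 < x → hφ.monotone_ext.stieltjesFunction x = φ x := by
    intro x hx
    rw [Monotone.stieltjesFunction_eq, (hψ hx).continuousWithinAt.rightLim_eq, max_eq_left hx.le]
  have hneg : ∀ {x : ℝ}, x < 0 → hφ.monotone_ext.stieltjesFunction x = 0 := by
    intro x hx
    have : ContinuousAt (fun t : ℝ => φ (max t 0)) x := by
      refine (continuousAt_const (y := φ 0)).congr ?_
      filter_upwards [gt_mem_nhds hx] with y hy
      rw [max_eq_right hy.le]
    rw [Monotone.stieltjesFunction_eq, this.continuousWithinAt.rightLim_eq, max_eq_right hx.le]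
    exact (hφ.eq_zero_iff 0 le_rfl).2 rfl
  have hbot : Tendsto hφ.monotone_ext.stieltjesFunction atBot (𝓝 0) := by
    refine tendsto_const_nhds.congr' ?_
    filter_upwards [eventually_lt_atBot 0] with x hx
    exact (hneg hx).symm
  have hcont : ContinuousAt hφ.monotone_ext.stieltjesFunction a := by
    refine (hφ.continuousAt ha).congr ?_
    filter_upwards [lt_mem_nhds ha] with y hy
    exact (hpos hy).symm
  rw [stieltjes, StieltjesFunction.measure_Iio _ hbot, hcont.continuousWithinAt.leftLim_eq,
    hpos ha, sub_zero]

theorem ofReal_lt_eq_Iio {b : ℝ} (hb : 0 < b) :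
    {t : ℝ | ENNReal.ofReal t < ENNReal.ofReal b} = Iio b := by
  ext t; simp [ENNReal.ofReal_lt_ofReal_iff hb]

theorem stieltjes_ofReal_lt (hφ : IsQuasiConcave φ) {b : ℝ} (hb : 0 < b) :
    stieltjes hφ {t | ENNReal.ofReal t < ENNReal.ofReal b} = ENNReal.ofReal (φ b) := by
  rw [ofReal_lt_eq_Iio hb, stieltjes_Iio hφ hb]

theorem eq_zero_or_ofReal_or_top (d : ℝ≥0∞) :
    d = 0 ∨ (∃ b : ℝ, 0 < b ∧ d = ENNReal.ofReal b) ∨ d = ∞ := by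
  rcases eq_or_ne d ∞ with h | h
  · exact Or.inr (Or.inr h)
  rcases eq_or_ne d 0 with h0 | h0
  · exact Or.inl h0
  · exact Or.inr (Or.inl ⟨d.toReal, ENNReal.toReal_pos h0 h, (ENNReal.ofReal_toReal h).symm⟩)

/-- For finite `d = b` this is `φ(b/a) ≤ φ(b)/a`. It is the dilation bound on a single level set. -/
theorem stieltjes_mul_lt_le (hφ : IsQuasiConcave φ) {a : ℝ} (ha : 0 < a) (ha1 : a ≤ 1)
    (d : ℝ≥0∞) : stieltjes hφ {t | ENNReal.ofReal (a * t) < d} ≤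
      ENNReal.ofReal a⁻¹ * stieltjes hφ {t | ENNReal.ofReal t < d} := by
  rcases eq_zero_or_ofReal_or_top d with rfl | ⟨b, hb, rfl⟩ | rfl
  · simp
  · have hba : 0 < b / a := by positivity
    have : {t | ENNReal.ofReal (a * t) < ENNReal.ofReal b} = Iio (b / a) := by
      ext t; simp [ENNReal.ofReal_lt_ofReal_iff hb, lt_div_iff₀ ha, mul_comm]
    rw [this, stieltjes_Iio hφ hba, stieltjes_ofReal_lt hφ hb,
      ← ENNReal.ofReal_mul (by positivity)]
    refine ENNReal.ofReal_le_ofReal ?_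
    have h := hφ.mul_le_mul hb ((le_div_iff₀ ha).2 (by nlinarith) : b ≤ b / a)
    have h2 : b * φ (b / a) ≤ b * (a⁻¹ * φ b) := by
      calc _ ≤ _ := h
        _ = _ := by ring
    exact le_of_mul_le_mul_left h2 hb
  · have : (1 : ℝ≥0∞) ≤ ENNReal.ofReal a⁻¹ := by
      rw [ENNReal.one_le_ofReal]; exact (one_le_inv₀ ha).2 ha1
    simpa using le_mul_of_one_le_left (zero_le (a := stieltjes hφ univ)) this

/-- Monotonicity of the measure settles `d ≥ t`; for `d = b ≤ t` it is `b φ(t) ≤ t φ(b)`. Integrated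
over levels, it bounds `S(g*)` by `‖g‖/φ`. -/
theorem min_mul_le_stieltjes (hφ : IsQuasiConcave φ) {t : ℝ} (ht : 0 < t) (d : ℝ≥0∞) :
    min (ENNReal.ofReal t) d * ENNReal.ofReal (φ t) ≤
      ENNReal.ofReal t * stieltjes hφ {x | ENNReal.ofReal x < d} := by
  rcases le_total (ENNReal.ofReal t) d with h | h
  · rw [min_eq_left h, ← stieltjes_ofReal_lt hφ ht]
    exact mul_le_mul_right (measure_mono fun x (hx : _ < _) => hx.trans_le h) _
  rw [min_eq_right h]
  rcases eq_zero_or_ofReal_or_top d with rfl | ⟨b, hb, rfl⟩ | rfl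
  · simp
  · rw [stieltjes_ofReal_lt hφ hb, ← ENNReal.ofReal_mul hb.le, ← ENNReal.ofReal_mul ht.le]
    exact ENNReal.ofReal_le_ofReal
      (hφ.mul_le_mul hb ((ENNReal.ofReal_le_ofReal_iff ht.le).1 h))
  · simp at h

variable {𝕜 : Type*} [RCLike 𝕜]

theorem lorentzNorm_eq_superlevel (hφ : IsQuasiConcave φ) (g : ℝ → 𝕜) :
    lorentzNorm hφ g = ∫⁻ s in Ioi (0 : ℝ),
      stieltjes hφ {t | ENNReal.ofReal t < distrib g (ENNReal.ofReal s)} := by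
  rw [lorentzNorm, lintegral_eq_lintegral_superlevel _ (antitone_rearr g).measurable.aemeasurable]
  simp_rw [lt_rearr_iff]

theorem lintegral_rearr_comp_mul_le (hφ : IsQuasiConcave φ) (g : ℝ → 𝕜) {a : ℝ} (ha : 0 < a)
    (ha1 : a ≤ 1) :
    ∫⁻ t, rearr g (a * t) ∂(stieltjes hφ) ≤ ENNReal.ofReal a⁻¹ * lorentzNorm hφ g := by
  have hm : Measurable fun t => rearr g (a * t) :=
    (antitone_rearr g).measurable.comp (measurable_const_mul a)
  rw [lintegral_eq_lintegral_superlevel _ hm.aemeasurable, lorentzNorm_eq_superlevel,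
    ← lintegral_const_mul' _ _ ENNReal.ofReal_ne_top]
  simp_rw [lt_rearr_iff]
  exact lintegral_mono fun s => stieltjes_mul_lt_le hφ ha ha1 _

theorem lintegral_rearr_mul_le (hφ : IsQuasiConcave φ) (g : ℝ → 𝕜) {t : ℝ} (ht : 0 < t) :
    (∫⁻ r in Ioc 0 t, rearr g r) * ENNReal.ofReal (φ t) ≤
      ENNReal.ofReal t * lorentzNorm hφ g := by
  rw [lintegral_eq_lintegral_superlevel _ (antitone_rearr g).measurable.aemeasurable,
    lorentzNorm_eq_superlevel, ← lintegral_const_mul' _ _ ENNReal.ofReal_ne_top,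
    ← lintegral_mul_const' _ _ ENNReal.ofReal_ne_top]
  simp_rw [lt_rearr_iff]
  refine lintegral_mono fun s => le_trans (mul_le_mul_left ?_ _) (min_mul_le_stieltjes hφ ht _)
  refine le_min ((measure_mono (subset_univ _)).trans (by simp)) ?_
  rw [Measure.restrict_apply₀' measurableSet_Ioc.nullMeasurableSet]
  conv_rhs => rw [← volume_pos_lt (distrib g (ENNReal.ofReal s))]
  exact measure_mono fun x hx => ⟨hx.2.1, hx.1⟩

theorem hardyPos_rearr_le (hφ : IsQuasiConcave φ) (g : ℝ → 𝕜) {t : ℝ} (ht : 0 < t) :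
    hardyPos (rearr g) t ≤ lorentzNorm hφ g / ENNReal.ofReal (φ t) := by
  have hφt : ENNReal.ofReal (φ t) ≠ 0 := by simpa using hφ.pos ht
  rw [ENNReal.le_div_iff_mul_le (Or.inl hφt) (Or.inl ENNReal.ofReal_ne_top), hardyPos, mul_assoc,
    ← ENNReal.div_eq_inv_mul]
  refine ENNReal.div_le_of_le_mul' (lintegral_rearr_mul_le hφ g ht)

theorem hardyPos_rearr_lt_top {hφ : IsQuasiConcave φ} {g : ℝ → 𝕜} (hg : lorentzNorm hφ g < ∞)
    {t : ℝ} (ht : 0 < t) : hardyPos (rearr g) t < ∞ :=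
  (hardyPos_rearr_le hφ g ht).trans_lt (ENNReal.div_lt_top hg.ne (by simpa using hφ.pos ht))

theorem lintegral_rearr_lt_top {hφ : IsQuasiConcave φ} {g : ℝ → 𝕜} (hg : lorentzNorm hφ g < ∞)
    {t : ℝ} (ht : 0 < t) : ∫⁻ r in Ioc 0 t, rearr g r < ∞ := by
  by_contra! h
  have := hardyPos_rearr_lt_top hg ht
  rw [hardyPos, top_le_iff.1 h, ENNReal.mul_top (by simp)] at this
  exact this.ne rfl

theorem ne_top_of_lintegral_stieltjes (hφ : IsQuasiConcave φ) {h : ℝ → ℝ≥0∞} (hh : Antitone h)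
    (hfin : ∫⁻ t, h t ∂(stieltjes hφ) < ∞) {x : ℝ} (hx : 0 < x) : h x ≠ ∞ := by
  intro htop
  have h1 : h x * ENNReal.ofReal (φ x) ≤ ∫⁻ t, h t ∂(stieltjes hφ) := by
    calc h x * ENNReal.ofReal (φ x) = ∫⁻ _ in Iio x, h x ∂(stieltjes hφ) := by
          simp [stieltjes_Iio hφ hx]
      _ ≤ ∫⁻ t in Iio x, h t ∂(stieltjes hφ) :=
          setLIntegral_mono' measurableSet_Iio fun y hy => hh (le_of_lt hy)
      _ ≤ _ := setLIntegral_le_lintegral _ _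
  rw [htop, ENNReal.top_mul (by simpa using hφ.pos hx)] at h1
  exact hfin.not_ge h1

theorem toScalar_mem_lorentz (hφ : IsQuasiConcave φ) {h : ℝ → ℝ≥0∞} (hh : Antitone h)
    (hfin : ∫⁻ t, h t ∂(stieltjes hφ) < ∞) : toScalar 𝕜 h ∈ lorentz 𝕜 hφ :=
  ⟨(measurable_toScalar hh.measurable).aestronglyMeasurable,
    (lintegral_mono fun t => rearr_toScalar_le hh t).trans_lt hfin⟩

/-- By Hardy-Littlewood, passing from a decreasing weight to a genuine scalar function loses nothing
in `S`; only values on `(0, ∞)` enter. -/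
theorem hardyPos_le_hardyPos_rearr_toScalar {h : ℝ → ℝ≥0∞} (hh : Antitone h)
    (hfin : ∀ x, 0 < x → h x ≠ ∞) (t : ℝ) :
    hardyPos h t ≤ hardyPos (rearr (toScalar 𝕜 h)) t := by
  refine mul_le_mul_right (le_trans (le_of_eq ?_) (lintegral_enorm_le_lintegral_rearr
    (measurable_toScalar (𝕜 := 𝕜) hh.measurable).aestronglyMeasurable t)) _
  exact setLIntegral_congr_fun measurableSet_Ioc fun x hx => (enorm_toScalar (hfin x hx.1)).symm

/-- Membership in `L^{1,∞} + L^∞` is automatic. Cut `f` at height `f*(1)`: the part above lives on a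
set of measure at most 1, so its rearrangement vanishes for `t ≥ 1`, while for `t ≤ 1` one has `t
f*(t) ≤ ∫_0^1 g*`. -/
theorem memWeakL1AddLinfty_of_majorant {hφ : IsQuasiConcave φ} {f g : ℝ → 𝕜}
    (hf : AEStronglyMeasurable f posVol) (hg : g ∈ majorants hφ f) : MemWeakL1AddLinfty f := by
  set M := rearr f 1 with hM
  have hMtop : M < ∞ := (hg.2 1 one_pos).trans_lt (hardyPos_rearr_lt_top hg.1.2 one_pos)
  set E : Set ℝ := {x | M < ‖f x‖ₑ} with hE
  have hEm : NullMeasurableSet E posVol := nullMeasurableSet_lt aemeasurable_const hf.enorm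
  refine ⟨E.indicator f, Eᶜ.indicator f, ⟨hf.indicator₀ hEm,
    ∫⁻ r in Ioc 0 1, rearr g r, (lintegral_rearr_lt_top hg.1.2 one_pos).ne, fun t ht => ?_⟩,
    ?_, ?_⟩
  · rcases le_total t 1 with h | h
    · have h1 : rearr (E.indicator f) t ≤ rearr f t :=
        rearr_le_rearr (distrib_mono_ae (.of_forall fun x => norm_indicator_le_norm_self _ _)) t
      calc ENNReal.ofReal t * rearr (E.indicator f) t
          ≤ ENNReal.ofReal t * hardyPos (rearr g) t := mul_le_mul_right (h1.trans (hg.2 t ht)) _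
        _ = ∫⁻ r in Ioc 0 t, rearr g r := by
          rw [hardyPos, ← mul_assoc, ENNReal.mul_inv_cancel (by simpa using ht) (by simp), one_mul]
        _ ≤ _ := lintegral_mono_set (Ioc_subset_Ioc_right h)
    · have : rearr (E.indicator f) t ≤ 0 := by
        rw [rearr_le_iff]
        refine le_trans (measure_mono fun x hx => ?_)
          (((rearr_le_iff f 1 M).1 le_rfl).trans (ENNReal.ofReal_le_ofReal h))
        by_contra hxE
        simp at hx
        exact hxE hx.1
      simp [nonpos_iff_eq_zero.1 this]
  · refine memLp_top_of_bound (hf.indicator₀ hEm.compl) M.toReal (.of_forall fun x => ?_)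
    by_cases hx : x ∈ E
    · simp [hx]
    · have hx' : ‖f x‖ₑ ≤ M := not_lt.1 hx
      rw [indicator_of_mem (show x ∈ Eᶜ from hx), ← toReal_enorm]
      exact ENNReal.toReal_mono hMtop.ne hx'
  · exact .of_eq (indicator_self_add_compl E f).symm

theorem mem_rangeSpace_of_majorant {hφ : IsQuasiConcave φ} {f g : ℝ → 𝕜}
    (hf : AEStronglyMeasurable f posVol) (hg : g ∈ majorants hφ f) : f ∈ rangeSpace 𝕜 hφ :=
  ⟨memWeakL1AddLinfty_of_majorant hf hg, g, hg⟩

theorem rangeNorm_le {hφ : IsQuasiConcave φ} {f g : ℝ → 𝕜} (hg : g ∈ majorants hφ f) :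
    rangeNorm hφ f ≤ lorentzNorm hφ g := iInf₂_le g hg

theorem aestronglyMeasurable_of_mem {hφ : IsQuasiConcave φ} {f : ℝ → 𝕜}
    (hf : f ∈ rangeSpace 𝕜 hφ) : AEStronglyMeasurable f posVol := by
  obtain ⟨⟨f₁, f₂, h1, h2, h⟩, -⟩ := hf
  exact (h1.1.add h2.1).congr h.symm

theorem rangeNorm_lt_top {hφ : IsQuasiConcave φ} {f : ℝ → 𝕜} (hf : f ∈ rangeSpace 𝕜 hφ) :
    rangeNorm hφ f < ∞ := by
  obtain ⟨-, g, hg⟩ := hf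
  exact (rangeNorm_le hg).trans_lt hg.1.2

theorem rearr_le_rangeNorm_div {hφ : IsQuasiConcave φ} (f : ℝ → 𝕜) {t : ℝ} (ht : 0 < t) :
    rearr f t ≤ rangeNorm hφ f / ENNReal.ofReal (φ t) := by
  have hφt : ENNReal.ofReal (φ t) ≠ 0 := by simpa using hφ.pos ht
  rw [ENNReal.le_div_iff_mul_le (Or.inl hφt) (Or.inl ENNReal.ofReal_ne_top)]
  refine le_iInf₂ fun g hg => ?_
  rw [← ENNReal.le_div_iff_mul_le (Or.inl hφt) (Or.inl ENNReal.ofReal_ne_top)]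
  exact (hg.2 t ht).trans (hardyPos_rearr_le hφ g ht)

/-- A countable quasi-triangle inequality, in terms of majorants. -/
theorem exists_majorant_of_enorm_le_tsum (hφ : IsQuasiConcave φ) {F : ℝ → 𝕜} {f g : ℕ → ℝ → 𝕜}
    (hF : ∀ᵐ x ∂posVol, ‖F x‖ₑ ≤ ∑' k, ‖f k x‖ₑ)
    (hg : ∀ k, g k ∈ majorants hφ (f k))
    (hsum : ∑' k, 2 ^ (k + 1) * lorentzNorm hφ (g k) < ∞) :
    ∃ G ∈ majorants hφ F, lorentzNorm hφ G ≤ ∑' k, 2 ^ (k + 1) * lorentzNorm hφ (g k) := by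
  have hpos : ∀ k : ℕ, (0 : ℝ) < (2 ^ (k + 1))⁻¹ := fun k => by positivity
  have hle : ∀ k : ℕ, ((2 : ℝ) ^ (k + 1))⁻¹ ≤ 1 := fun k =>
    inv_le_one_of_one_le₀ (one_le_pow₀ one_le_two)
  have hkanti : ∀ k, Antitone fun x => rearr (g k) ((2 ^ (k + 1))⁻¹ * x) := fun k x y hxy =>
    antitone_rearr _ (mul_le_mul_of_nonneg_left hxy (hpos k).le)
  set h : ℝ → ℝ≥0∞ := fun x => ∑' k, rearr (g k) ((2 ^ (k + 1))⁻¹ * x) with hh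
  have hanti : Antitone h := fun x y hxy => ENNReal.tsum_le_tsum fun k => hkanti k hxy
  have hint : ∫⁻ t, h t ∂(stieltjes hφ) ≤ ∑' k, 2 ^ (k + 1) * lorentzNorm hφ (g k) := by
    rw [hh, lintegral_tsum fun k => (hkanti k).measurable.aemeasurable]
    refine ENNReal.tsum_le_tsum fun k =>
      (lintegral_rearr_comp_mul_le hφ (g k) (hpos k) (hle k)).trans_eq ?_
    rw [inv_inv, ENNReal.ofReal_pow zero_le_two]
    simp
  have hfin := hint.trans_lt hsum
  refine ⟨toScalar 𝕜 h, ⟨toScalar_mem_lorentz hφ hanti hfin, fun t ht => ?_⟩,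
    (lintegral_mono fun t => rearr_toScalar_le hanti t).trans hint⟩
  refine le_trans ?_ (hardyPos_le_hardyPos_rearr_toScalar hanti
    (fun x hx => ne_top_of_lintegral_stieltjes hφ hanti hfin hx) t)
  rw [hh, hardyPos_tsum fun k => (hkanti k).measurable]
  refine (rearr_le_tsum_rearr hF t).trans (ENNReal.tsum_le_tsum fun k => ?_)
  rw [hardyPos_comp_mul (antitone_rearr (g k)).measurable (hpos k)]
  exact (hg k).2 _ (mul_pos (hpos k) ht)

/-- A countable quasi-triangle inequality for the quasi-norm of the range space. -/
theorem mem_rangeSpace_of_enorm_le_tsum (hφ : IsQuasiConcave φ) {F : ℝ → 𝕜} {f : ℕ → ℝ → 𝕜}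
    (hFm : AEStronglyMeasurable F posVol) (hF : ∀ᵐ x ∂posVol, ‖F x‖ₑ ≤ ∑' k, ‖f k x‖ₑ)
    (hsum : ∑' k, 2 ^ (k + 1) * rangeNorm hφ (f k) < ∞) :
    F ∈ rangeSpace 𝕜 hφ ∧ rangeNorm hφ F ≤ ∑' k, 2 ^ (k + 1) * rangeNorm hφ (f k) := by
  have h2 : ∀ k : ℕ, (2 : ℝ≥0∞) ^ (k + 1) ≠ 0 := fun k => by simp
  have h2' : ∀ k : ℕ, (2 : ℝ≥0∞) ^ (k + 1) ≠ ∞ := fun k => by finiteness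
  have key : ∀ ε : ℝ≥0∞, ε ≠ 0 → ε ≠ ∞ → ∃ G ∈ majorants hφ F,
      lorentzNorm hφ G ≤ (∑' k, 2 ^ (k + 1) * rangeNorm hφ (f k)) + ε := by
    intro ε hε hεt
    obtain ⟨δ, hδ, hδsum⟩ := ENNReal.exists_pos_sum_of_countable' hε ℕ
    -- Near-minimisers whose errors, after multiplication by the weights `2^(k+1)`, sum to at most
    -- `ε`.
    have hex : ∀ k, ∃ g ∈ majorants hφ (f k),
        lorentzNorm hφ g < rangeNorm hφ (f k) + δ k / 2 ^ (k + 1) := by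
      intro k
      have hk : rangeNorm hφ (f k) ≠ ∞ := by
        intro h
        have := ENNReal.ne_top_of_tsum_ne_top hsum.ne k
        rw [h, ENNReal.mul_top (h2 k)] at this
        exact this rfl
      have : rangeNorm hφ (f k) < rangeNorm hφ (f k) + δ k / 2 ^ (k + 1) :=
        ENNReal.lt_add_right hk (ENNReal.div_pos (hδ k).ne' (h2' k)).ne'
      conv_lhs at this => rw [rangeNorm]
      simpa only [iInf_lt_iff, exists_prop] using this
    choose g hg hgn using hex
    have hle : ∑' k, 2 ^ (k + 1) * lorentzNorm hφ (g k) ≤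
        (∑' k, 2 ^ (k + 1) * rangeNorm hφ (f k)) + ε := by
      calc ∑' k, 2 ^ (k + 1) * lorentzNorm hφ (g k)
          ≤ ∑' k, (2 ^ (k + 1) * rangeNorm hφ (f k) + δ k) := by
            refine ENNReal.tsum_le_tsum fun k => ?_
            refine (mul_le_mul_right (hgn k).le _).trans_eq ?_
            rw [mul_add, ENNReal.mul_div_cancel (h2 k) (h2' k)]
        _ = (∑' k, 2 ^ (k + 1) * rangeNorm hφ (f k)) + ∑' k, δ k := ENNReal.tsum_add
        _ ≤ _ := by gcongr
    obtain ⟨G, hG, hGn⟩ := exists_majorant_of_enorm_le_tsum hφ hF hg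
      (hle.trans_lt (ENNReal.add_lt_top.2 ⟨hsum, hεt.lt_top⟩))
    exact ⟨G, hG, hGn.trans hle⟩
  obtain ⟨G, hG, -⟩ := key 1 one_ne_zero ENNReal.one_ne_top
  refine ⟨mem_rangeSpace_of_majorant hFm hG, ENNReal.le_of_forall_pos_le_add fun ε hε _ => ?_⟩
  obtain ⟨G, hG, hGn⟩ := key ε (by exact_mod_cast hε.ne') ENNReal.coe_ne_top
  exact (rangeNorm_le hG).trans hGn

end Lorentz

/-! ### The range space: quasi-norm, completeness, optimality -/

section Range

variable {φ : ℝ → ℝ} {𝕜 : Type*} [RCLike 𝕜]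

theorem zero_mem_majorants (hφ : IsQuasiConcave φ) {f : ℝ → 𝕜} (hf : f =ᵐ[posVol] 0) :
    (0 : ℝ → 𝕜) ∈ majorants hφ f ∧ lorentzNorm hφ (0 : ℝ → 𝕜) = 0 := by
  have h0 : lorentzNorm hφ (0 : ℝ → 𝕜) = 0 := by
    simp [lorentzNorm, rearr_eq_zero_of_ae (EventuallyEq.refl _ (0 : ℝ → 𝕜))]
  refine ⟨⟨⟨aestronglyMeasurable_zero, ?_⟩, fun t _ => ?_⟩, h0⟩
  · rw [h0]; exact ENNReal.zero_lt_top
  · rw [rearr_eq_zero_of_ae hf]; exact zero_le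

theorem rangeNorm_eq_zero_of_ae (hφ : IsQuasiConcave φ) {f : ℝ → 𝕜} (hf : f =ᵐ[posVol] 0) :
    rangeNorm hφ f = 0 := by
  obtain ⟨h, h0⟩ := zero_mem_majorants hφ hf
  exact le_antisymm ((rangeNorm_le h).trans_eq h0) zero_le

theorem ae_eq_zero_of_rangeNorm {hφ : IsQuasiConcave φ} {f : ℝ → 𝕜} (h : rangeNorm hφ f = 0) :
    f =ᵐ[posVol] 0 :=
  ae_eq_zero_of_rearr fun t ht => le_antisymm
    ((rearr_le_rangeNorm_div f ht).trans_eq (by rw [h, ENNReal.zero_div])) zero_le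

theorem majorants_anti {hφ : IsQuasiConcave φ} {f f' : ℝ → 𝕜}
    (h : ∀ s, distrib f s ≤ distrib f' s) : majorants hφ f' ⊆ majorants hφ f :=
  fun _ hg => ⟨hg.1, fun t ht => (rearr_le_rearr h t).trans (hg.2 t ht)⟩

theorem mem_rangeSpace_of_distrib_le {hφ : IsQuasiConcave φ} {f f' : ℝ → 𝕜}
    (hf : AEStronglyMeasurable f posVol) (h : ∀ s, distrib f s ≤ distrib f' s)
    (hf' : f' ∈ rangeSpace 𝕜 hφ) :
    f ∈ rangeSpace 𝕜 hφ ∧ rangeNorm hφ f ≤ rangeNorm hφ f' := by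
  obtain ⟨-, g, hg⟩ := hf'
  exact ⟨mem_rangeSpace_of_majorant hf (majorants_anti h hg), biInf_mono (majorants_anti h)⟩

theorem lorentzNorm_smul (hφ : IsQuasiConcave φ) (c : 𝕜) (g : ℝ → 𝕜) :
    lorentzNorm hφ (c • g) = ‖c‖ₑ * lorentzNorm hφ g := by
  simp only [lorentzNorm, rearr_smul]
  exact lintegral_const_mul' _ _ enorm_ne_top

theorem smul_mem_majorants {hφ : IsQuasiConcave φ} {f g : ℝ → 𝕜} (c : 𝕜)
    (hg : g ∈ majorants hφ f) : c • g ∈ majorants hφ (c • f) := by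
  refine ⟨⟨hg.1.1.const_smul c, ?_⟩, fun t ht => ?_⟩
  · rw [lorentzNorm_smul]
    exact ENNReal.mul_lt_top enorm_lt_top hg.1.2
  · have : hardyPos (rearr (c • g)) t = ‖c‖ₑ * hardyPos (rearr g) t := by
      simp only [hardyPos, rearr_smul]
      rw [lintegral_const_mul' _ _ enorm_ne_top, mul_left_comm]
    rw [this, rearr_smul]
    exact mul_le_mul_right (hg.2 t ht) _

theorem rangeNorm_smul_le (hφ : IsQuasiConcave φ) (c : 𝕜) (f : ℝ → 𝕜) :
    rangeNorm hφ (c • f) ≤ ‖c‖ₑ * rangeNorm hφ f := by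
  rcases eq_or_ne c 0 with rfl | hc
  · rw [rangeNorm_eq_zero_of_ae hφ (by simp)]; exact zero_le
  have hc' : ‖c‖ₑ ≠ 0 := by simpa using hc
  conv_rhs => rw [rangeNorm, iInf_subtype', ENNReal.mul_iInf_of_ne hc' enorm_ne_top]
  refine le_iInf fun g => ?_
  rw [← lorentzNorm_smul]
  exact rangeNorm_le (smul_mem_majorants c g.2)

theorem rangeNorm_smul (hφ : IsQuasiConcave φ) (c : 𝕜) (f : ℝ → 𝕜) :
    rangeNorm hφ (c • f) = ‖c‖ₑ * rangeNorm hφ f := by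
  refine le_antisymm (rangeNorm_smul_le hφ c f) ?_
  rcases eq_or_ne c 0 with rfl | hc
  · simp
  have h := rangeNorm_smul_le hφ c⁻¹ (c • f)
  rw [inv_smul_smul₀ hc, enorm_inv hc] at h
  calc ‖c‖ₑ * rangeNorm hφ f ≤ ‖c‖ₑ * (‖c‖ₑ⁻¹ * rangeNorm hφ (c • f)) := mul_le_mul_right h _
    _ = rangeNorm hφ (c • f) := by
      rw [← mul_assoc, ENNReal.mul_inv_cancel (by simpa using hc) (by simp), one_mul]

/-- The countable inequality for `f, g, 0, 0, …` has weights 2 and 4, hence the constant 4. -/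
theorem rangeSpace_add {hφ : IsQuasiConcave φ} {f g : ℝ → 𝕜} (hf : f ∈ rangeSpace 𝕜 hφ)
    (hg : g ∈ rangeSpace 𝕜 hφ) : f + g ∈ rangeSpace 𝕜 hφ ∧
      rangeNorm hφ (f + g) ≤ 4 * (rangeNorm hφ f + rangeNorm hφ g) := by
  let u : ℕ → ℝ → 𝕜 := fun k => if k = 0 then f else if k = 1 then g else 0
  have hu : ∀ k ∉ Finset.range 2, u k = 0 := by
    intro k hk
    have : k ≠ 0 ∧ k ≠ 1 := by simp at hk; omega
    simp [u, this]
  have h1 : ∑' k, 2 ^ (k + 1) * rangeNorm hφ (u k) =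
      2 * rangeNorm hφ f + 4 * rangeNorm hφ g := by
    rw [tsum_eq_sum (s := Finset.range 2)
      fun k hk => by rw [hu k hk, rangeNorm_eq_zero_of_ae hφ .rfl, mul_zero]]
    rw [Finset.sum_range_succ, Finset.sum_range_one]
    norm_num [u]
  have h2 : ∑' k, 2 ^ (k + 1) * rangeNorm hφ (u k) ≤ 4 * (rangeNorm hφ f + rangeNorm hφ g) := by
    rw [h1, mul_add]
    gcongr
    norm_num
  have hlt : 4 * (rangeNorm hφ f + rangeNorm hφ g) < ∞ :=
    ENNReal.mul_lt_top (by norm_num)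
      (ENNReal.add_lt_top.2 ⟨rangeNorm_lt_top hf, rangeNorm_lt_top hg⟩)
  obtain ⟨h3, h4⟩ := mem_rangeSpace_of_enorm_le_tsum hφ (F := f + g) (f := u)
    ((aestronglyMeasurable_of_mem hf).add (aestronglyMeasurable_of_mem hg))
    (.of_forall fun x => by
      rw [tsum_eq_sum (s := Finset.range 2) fun k hk => by simp [hu k hk],
        Finset.sum_range_succ, Finset.sum_range_one]
      simpa [u] using enorm_add_le (f x) (g x))
    (h2.trans_lt hlt)
  exact ⟨h3, h4.trans h2⟩

theorem rangeSpace_sub {hφ : IsQuasiConcave φ} {f g : ℝ → 𝕜} (hf : f ∈ rangeSpace 𝕜 hφ)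
    (hg : g ∈ rangeSpace 𝕜 hφ) : f - g ∈ rangeSpace 𝕜 hφ := by
  obtain ⟨-, G, hG⟩ := id hg
  have h := mem_rangeSpace_of_majorant ((aestronglyMeasurable_of_mem hg).const_smul (-1 : 𝕜))
    (smul_mem_majorants (-1 : 𝕜) hG)
  have := (rangeSpace_add hf h).1
  rwa [neg_one_smul, ← sub_eq_add_neg] at this

/-- Since `φ(t) ≤ 2^(k+1) φ(t/2^(k+1))`, the weights absorb the dilations and the thresholds have a
finite sum. So the divergence set has measure at most `ε` for every `ε > 0`. -/
theorem ae_tsum_enorm_lt_top {hφ : IsQuasiConcave φ} {f : ℕ → ℝ → 𝕜}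
    (hsum : ∑' k, 2 ^ (k + 1) * rangeNorm hφ (f k) < ∞) :
    ∀ᵐ x ∂posVol, ∑' k, ‖f k x‖ₑ < ∞ := by
  have hfin : ∀ t : ℝ, 0 < t → ∑' k, rearr (f k) ((2 ^ (k + 1))⁻¹ * t) < ∞ := by
    intro t ht
    have hφt : ENNReal.ofReal (φ t) ≠ 0 := by simpa using hφ.pos ht
    have hle : ∀ k : ℕ, rearr (f k) ((2 ^ (k + 1))⁻¹ * t) ≤
        2 ^ (k + 1) * rangeNorm hφ (f k) / ENNReal.ofReal (φ t) := by
      intro k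
      have hp : (0 : ℝ) < 2 ^ (k + 1) := by positivity
      have ht' : 0 < (2 ^ (k + 1) : ℝ)⁻¹ * t := by positivity
      have h1 : φ t ≤ 2 ^ (k + 1) * φ ((2 ^ (k + 1) : ℝ)⁻¹ * t) := by
        have h := hφ.mul_le_mul ht'
          (mul_le_of_le_one_left ht.le (inv_le_one_of_one_le₀ (one_le_pow₀ one_le_two)))
        rw [mul_assoc, inv_mul_le_iff₀ hp, mul_left_comm] at h
        exact le_of_mul_le_mul_left h ht
      have h2 : ENNReal.ofReal (φ t) ≤
          2 ^ (k + 1) * ENNReal.ofReal (φ ((2 ^ (k + 1) : ℝ)⁻¹ * t)) := by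
        refine (ENNReal.ofReal_le_ofReal h1).trans_eq ?_
        rw [ENNReal.ofReal_mul hp.le, ENNReal.ofReal_pow zero_le_two, ENNReal.ofReal_ofNat]
      refine (rearr_le_rangeNorm_div (hφ := hφ) (f k) ht').trans ?_
      rw [ENNReal.le_div_iff_mul_le (Or.inl hφt) (Or.inl ENNReal.ofReal_ne_top)]
      refine (mul_le_mul_right h2 _).trans ?_
      rw [mul_left_comm]
      exact mul_le_mul_right (ENNReal.mul_le_of_le_div le_rfl) _
    refine (ENNReal.tsum_le_tsum hle).trans_lt ?_
    simp only [div_eq_mul_inv]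
    rw [ENNReal.tsum_mul_right]
    exact ENNReal.mul_lt_top hsum (by simpa using hφ.pos ht)
  rw [ae_iff, ← nonpos_iff_eq_zero]
  refine ENNReal.le_of_forall_pos_le_add fun ε hε _ => ?_
  have hε' : (0 : ℝ) < ε := by exact_mod_cast hε
  rw [zero_add, ← ENNReal.ofReal_coe_nnreal]
  refine (measure_mono fun x hx => ?_).trans (posVol_tsum_rearr_lt_le f ε)
  exact (hfin ε hε').trans_le (not_lt.1 hx)

/-- Along a subsequence with increments at most `8^(-k)`, the weights `2^(k+1)` are still summable.
The telescoping series converges a.e., and the countable inequality applied to its tails bounds the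
distance to the limit. -/
theorem rangeSpace_complete (hφ : IsQuasiConcave φ) {u : ℕ → ℝ → 𝕜}
    (hu : ∀ n, u n ∈ rangeSpace 𝕜 hφ)
    (hc : ∀ ε : ℝ≥0∞, 0 < ε → ∃ n₀, ∀ m ≥ n₀, ∀ n ≥ n₀, rangeNorm hφ (u m - u n) ≤ ε) :
    ∃ f ∈ rangeSpace 𝕜 hφ, Tendsto (fun n => rangeNorm hφ (u n - f)) atTop (𝓝 0) := by
  have hpos : ∀ k : ℕ, (0 : ℝ≥0∞) < 8⁻¹ ^ k := fun k => ENNReal.pow_pos (by simp) k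
  choose n₀ hn₀ using fun k : ℕ => hc (8⁻¹ ^ k) (hpos k)
  -- Partial sums ensure that both `m k` and `m (k + 1)` are at least `n₀ k`.
  set m : ℕ → ℕ := fun k => ∑ i ∈ Finset.range (k + 1), n₀ i with hm
  have hmn : ∀ k, n₀ k ≤ m k := fun k =>
    Finset.single_le_sum (f := n₀) (fun _ _ => Nat.zero_le _) (Finset.self_mem_range_succ k)
  have hmn' : ∀ k, n₀ k ≤ m (k + 1) := fun k => by
    refine (hmn k).trans ?_
    simp only [hm]
    rw [Finset.sum_range_succ _ (k + 1)]
    exact Nat.le_add_right _ _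
  set v : ℕ → ℝ → 𝕜 := fun k => u (m k) with hv
  set d : ℕ → ℝ → 𝕜 := fun k => v k - v (k + 1) with hd
  have hdN : ∀ k, rangeNorm hφ (d k) ≤ 8⁻¹ ^ k := fun k => hn₀ k _ (hmn k) _ (hmn' k)
  set c : ℝ≥0∞ := ∑' k : ℕ, 2 ^ (k + 1) * 8⁻¹ ^ k with hcdef
  have hcfin : c < ∞ := by
    have : ∀ k : ℕ, (2 : ℝ≥0∞) ^ (k + 1) * 8⁻¹ ^ k = 2 * 4⁻¹ ^ k := by
      intro k
      have h8 : (2 : ℝ≥0∞) * 8⁻¹ = 4⁻¹ := by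
        rw [show (8 : ℝ≥0∞) = 2 * 4 by norm_num, ENNReal.mul_inv (by simp) (by simp), ← mul_assoc,
          ENNReal.mul_inv_cancel (by simp) (by simp), one_mul]
      rw [← h8, mul_pow, pow_succ, mul_comm _ (2 : ℝ≥0∞), mul_assoc]
    simp_rw [hcdef, this]
    rw [ENNReal.tsum_mul_left, ENNReal.tsum_geometric]
    refine ENNReal.mul_lt_top (by simp) (ENNReal.inv_lt_top.2 (tsub_pos_of_lt ?_))
    exact ENNReal.inv_lt_one.2 (by norm_num)
  have htail : ∀ K, ∑' j, 2 ^ (j + 1) * rangeNorm hφ (d (K + j)) ≤ 8⁻¹ ^ K * c := by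
    intro K
    rw [hcdef, ← ENNReal.tsum_mul_left]
    refine ENNReal.tsum_le_tsum fun j => (mul_le_mul_right (hdN (K + j)) _).trans_eq ?_
    rw [pow_add 8⁻¹, mul_left_comm]
  have htail_fin : ∀ K, ∑' j, 2 ^ (j + 1) * rangeNorm hφ (d (K + j)) < ∞ := fun K =>
    (htail K).trans_lt (ENNReal.mul_lt_top (ENNReal.pow_lt_top (by simp)) hcfin)
  have hvm : ∀ k, AEStronglyMeasurable (v k) posVol := fun k => aestronglyMeasurable_of_mem (hu _)
  have hed : ∀ x k, edist (v k x) (v (k + 1) x) ≤ ‖d k x‖ₑ := fun x k => by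
    rw [edist_eq_enorm_sub]; rfl
  have hlim : ∀ᵐ x ∂posVol, ∃ l, Tendsto (fun k => v k x) atTop (𝓝 l) := by
    have h0 := htail_fin 0
    simp only [zero_add] at h0
    filter_upwards [ae_tsum_enorm_lt_top h0] with x hx
    exact cauchySeq_tendsto_of_complete
      (cauchySeq_of_edist_le_of_tsum_ne_top (fun k => ‖d k x‖ₑ) (hed x) hx.ne)
  obtain ⟨f, hfm, hf⟩ := exists_stronglyMeasurable_limit_of_tendsto_ae hvm hlim
  have hvf : ∀ K, v K - f ∈ rangeSpace 𝕜 hφ ∧ rangeNorm hφ (v K - f) ≤ 8⁻¹ ^ K * c := by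
    intro K
    obtain ⟨h1, h2⟩ := mem_rangeSpace_of_enorm_le_tsum hφ (F := v K - f)
      (f := fun j => d (K + j)) ((hvm K).sub hfm.aestronglyMeasurable) (by
        filter_upwards [hf] with x hx
        have := edist_le_tsum_of_edist_le_of_tendsto (fun k => ‖d k x‖ₑ) (hed x) hx K
        rwa [edist_eq_enorm_sub] at this) (htail_fin K)
    exact ⟨h1, h2.trans (htail K)⟩
  have hfY : f ∈ rangeSpace 𝕜 hφ := by
    simpa [hv] using rangeSpace_sub (hu (m 0)) (hvf 0).1
  refine ⟨f, hfY, ENNReal.tendsto_nhds_zero.2 fun ε hε => ?_⟩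
  -- The 4 is the quasi-triangle constant; 1 and `c` come from `u n - v K` and `v K - f`.
  have hK : Tendsto (fun K : ℕ => 4 * (1 + c) * (8⁻¹ : ℝ≥0∞) ^ K) atTop (𝓝 0) := by
    have h := ENNReal.Tendsto.const_mul (a := 4 * (1 + c))
      (ENNReal.tendsto_pow_atTop_nhds_zero_of_lt_one (r := 8⁻¹)
        (ENNReal.inv_lt_one.2 (by norm_num))) (Or.inr (by finiteness))
    rwa [mul_zero] at h
  obtain ⟨K, hK⟩ := (ENNReal.tendsto_nhds_zero.1 hK ε hε).exists
  filter_upwards [eventually_ge_atTop (n₀ K)] with n hn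
  have h1 := (rangeSpace_add (rangeSpace_sub (hu n) (hu (m K))) (hvf K).1).2
  have h2 : u n - u (m K) + (v K - f) = u n - f := by simp [hv]
  rw [h2] at h1
  refine h1.trans (le_trans ?_ hK)
  rw [mul_assoc, add_mul, one_mul, mul_comm c]
  exact mul_le_mul_right (add_le_add (hn₀ K n hn _ (hmn K)) (hvf K).2) _

theorem indicator_mem_rangeSpace (hφ : IsQuasiConcave φ) {A : Set ℝ} (hA : MeasurableSet A)
    (hfin : posVol A < ∞) : A.indicator (fun _ => (1 : 𝕜)) ∈ rangeSpace 𝕜 hφ := by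
  set f : ℝ → 𝕜 := A.indicator (fun _ => (1 : 𝕜)) with hf
  have hm : AEStronglyMeasurable f posVol := aestronglyMeasurable_const.indicator hA
  -- The extra 1 keeps the endpoint positive, as `stieltjes_Iio` requires, even when `A` is null.
  have hle : ∀ t, rearr f t ≤ (Iio ((posVol A).toReal + 1)).indicator 1 t := by
    intro t
    rw [rearr_le_iff]
    by_cases ht : t < (posVol A).toReal + 1
    · rw [indicator_of_mem (show t ∈ Iio _ from ht)]
      have : distrib f (1 : ℝ≥0∞) = 0 := by
        refine measure_mono_null (t := ∅) (fun x hx => ?_) measure_empty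
        have hx' : 1 < ‖f x‖ₑ := hx
        by_cases hxA : x ∈ A <;> simp [hf, hxA] at hx'
      simp [this]
    · rw [indicator_of_notMem (show t ∉ Iio _ from ht)]
      refine (measure_mono (t := A) fun x hx => ?_).trans ?_
      · by_contra hxA
        simp [hf, hxA] at hx
      · rw [← ENNReal.ofReal_toReal hfin.ne]
        exact ENNReal.ofReal_le_ofReal (by linarith)
  have hpos : 0 < (posVol A).toReal + 1 := by positivity
  refine mem_rangeSpace_of_majorant hm (g := f) ⟨⟨hm, ?_⟩, fun t ht =>
    le_hardyPos (antitone_rearr f) ht⟩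
  refine (lintegral_mono hle).trans_lt ?_
  rw [lintegral_indicator_one measurableSet_Iio, stieltjes_Iio hφ hpos]
  exact ENNReal.ofReal_lt_top

theorem isRIQuasiBanach_rangeSpace (hφ : IsQuasiConcave φ) :
    IsRIQuasiBanach (rangeSpace 𝕜 hφ) (rangeNorm hφ) where
  aestronglyMeasurable _ hf := aestronglyMeasurable_of_mem hf
  lt_top _ hf := rangeNorm_lt_top hf
  eq_zero_iff _ _ := ⟨ae_eq_zero_of_rangeNorm, rangeNorm_eq_zero_of_ae hφ⟩
  smul c f hf := by
    obtain ⟨-, g, hg⟩ := id hf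
    exact ⟨mem_rangeSpace_of_majorant ((aestronglyMeasurable_of_mem hf).const_smul c)
      (smul_mem_majorants c hg), rangeNorm_smul hφ c f⟩
  add := ⟨4, by norm_num, fun _ hf _ hg => rangeSpace_add hf hg⟩
  ideal _ hg _ hf hle := mem_rangeSpace_of_distrib_le hf (distrib_mono_ae hle) hg
  rearrangementInvariant g hg f hf h := by
    have h1 := mem_rangeSpace_of_distrib_le hf (fun s => (h s).le) hg
    exact ⟨h1.1, h1.2.antisymm (mem_rangeSpace_of_distrib_le (aestronglyMeasurable_of_mem hg)
      (fun s => (h s).ge) h1.1).2⟩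
  indicator_mem _ hA hfin := indicator_mem_rangeSpace hφ hA hfin
  complete _ hu hc := rangeSpace_complete hφ hu hc

theorem integrableOn_of_mem_lorentz {hφ : IsQuasiConcave φ} {g : ℝ → 𝕜}
    (hg : g ∈ lorentz 𝕜 hφ) {t : ℝ} (ht : 0 < t) : IntegrableOn g (Ioc 0 t) :=
  ⟨hg.1.mono_measure (Measure.restrict_mono (fun _ hx => hx.1) le_rfl),
    (lintegral_enorm_le_lintegral_rearr hg.1 t).trans_lt (lintegral_rearr_lt_top hg.2 ht)⟩

theorem enorm_hardy_le {g : ℝ → 𝕜} (hg : AEStronglyMeasurable g posVol) {t : ℝ} (ht : 0 < t) :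
    ‖hardy g t‖ₑ ≤ hardyPos (rearr g) t := by
  rw [hardy, enorm_smul, hardyPos, enorm_inv ht.ne', Real.enorm_eq_ofReal ht.le]
  exact mul_le_mul_right ((enorm_integral_le_lintegral_enorm _).trans
    (lintegral_enorm_le_lintegral_rearr hg t)) _

theorem aestronglyMeasurable_hardy {g : ℝ → 𝕜} (hg : ∀ t : ℝ, 0 < t → IntegrableOn g (Ioc 0 t)) :
    AEStronglyMeasurable (hardy g) posVol := by
  refine ContinuousOn.aestronglyMeasurable (fun t ht => ?_) measurableSet_Ioi
  have ht' : (0 : ℝ) < t := ht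
  have h1 : ContinuousOn (fun x => ∫ r in Ioc 0 x, g r) (Icc 0 (t + 1)) :=
    intervalIntegral.continuousOn_primitive
      ((integrableOn_Icc_iff_integrableOn_Ioc).2 (hg (t + 1) (by linarith)))
  have h2 : ContinuousAt (fun x => ∫ r in Ioc 0 x, g r) t :=
    h1.continuousAt (Icc_mem_nhds ht' (by linarith))
  exact ((continuousAt_inv₀ ht'.ne').smul h2).continuousWithinAt

theorem hardyBounded_rangeSpace (hφ : IsQuasiConcave φ) :
    HardyBounded hφ (rangeSpace 𝕜 hφ) (rangeNorm hφ) := by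
  refine ⟨fun g hg t ht => integrableOn_of_mem_lorentz hg ht, 1, ENNReal.one_ne_top,
    fun g hg => ?_⟩
  have hmaj : g ∈ majorants hφ (hardy g) := ⟨hg, fun t ht => rearr_le_of_ae fun x hx htx =>
    (enorm_hardy_le hg.1 hx).trans (hardyPos_antitoneOn (antitone_rearr g) ht hx htx)⟩
  refine ⟨mem_rangeSpace_of_majorant (aestronglyMeasurable_hardy fun t ht =>
    integrableOn_of_mem_lorentz hg ht) hmaj, ?_⟩
  rw [one_mul]
  exact rangeNorm_le hmaj

theorem enorm_hardy_toScalar {h : ℝ → ℝ≥0∞} (hh : Antitone h) {t : ℝ} (ht : 0 < t)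
    (hfin : ∫⁻ r in Ioc 0 t, h r < ∞) : ‖hardy (toScalar 𝕜 h) t‖ₑ = hardyPos h t := by
  have h1 : ∫ r in Ioc 0 t, toScalar 𝕜 h r =
      (((∫⁻ r in Ioc 0 t, h r).toReal : ℝ) : 𝕜) := by
    simp only [toScalar]
    rw [integral_ofReal, integral_toReal hh.measurable.aemeasurable
      (ae_lt_top hh.measurable hfin.ne)]
  rw [hardy, enorm_smul, hardyPos, enorm_inv ht.ne', Real.enorm_eq_ofReal ht.le, h1]
  congr 1
  exact enorm_toScalar (h := fun _ => ∫⁻ r in Ioc 0 t, h r) (x := t) hfin.ne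

/-- The scalar copy of `g*` is nonnegative, so the modulus of its Hardy transform is exactly
`S(g*)`. This lies in `X` and dominates `f*`, which is equimeasurable with `f`. The infimum over `g`
then gives the norm bound with the same constant `C`. -/
theorem rangeSpace_embeds (hφ : IsQuasiConcave φ) {X : Set (ℝ → 𝕜)} {N : (ℝ → 𝕜) → ℝ≥0∞}
    (hX : IsRIQuasiBanach X N) (hS : HardyBounded hφ X N) :
    Embeds (rangeSpace 𝕜 hφ) (rangeNorm hφ) X N := by
  obtain ⟨-, C, hC, hS⟩ := hS
  have key : ∀ f : ℝ → 𝕜, AEStronglyMeasurable f posVol → ∀ g ∈ majorants hφ f,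
      f ∈ X ∧ N f ≤ C * lorentzNorm hφ g := by
    intro f hf g hg
    have hgfin := hg.1.2
    have hfin : ∀ t, 0 < t → rearr f t ≠ ∞ := fun t ht =>
      ((hg.2 t ht).trans_lt (hardyPos_rearr_lt_top hgfin ht)).ne
    have hlor := toScalar_mem_lorentz (𝕜 := 𝕜) hφ (antitone_rearr g) hgfin
    obtain ⟨hmem, hN⟩ := hS _ hlor
    have hle : ∀ᵐ x ∂posVol, ‖toScalar 𝕜 (rearr f) x‖ ≤ ‖hardy (toScalar 𝕜 (rearr g)) x‖ := by
      filter_upwards [ae_restrict_mem measurableSet_Ioi] with x hx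
      rw [← enorm_le_iff_norm_le, enorm_toScalar (hfin x hx),
        enorm_hardy_toScalar (antitone_rearr g) hx (lintegral_rearr_lt_top hgfin hx)]
      exact hg.2 x hx
    obtain ⟨h1, h2⟩ := hX.ideal _ hmem _
      (measurable_toScalar (antitone_rearr f).measurable).aestronglyMeasurable hle
    obtain ⟨h3, h4⟩ := hX.rearrangementInvariant _ h1 f hf
      fun s => (distrib_toScalar_rearr hfin s).symm
    refine ⟨h3, h4.trans_le (h2.trans (hN.trans (mul_le_mul_right ?_ _)))⟩
    exact lintegral_mono fun t => rearr_toScalar_le (antitone_rearr g) t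
  refine ⟨fun f hf => ?_, C, hC, fun f hf => ?_⟩
  · obtain ⟨-, g, hg⟩ := id hf
    exact (key f (aestronglyMeasurable_of_mem hf) g hg).1
  · have hne : (majorants hφ f).Nonempty := hf.2
    have := hne.to_subtype
    rw [rangeNorm, iInf_subtype', ENNReal.mul_iInf fun h => absurd h hC]
    exact le_iInf fun g => (key f (aestronglyMeasurable_of_mem hf) g g.2).2

end Range

end HardyRange

theorem theorem3p2 {𝕜 : Type*} [RCLike 𝕜] (φ : ℝ → ℝ) (hφ : IsQuasiConcave φ) :
    IsOptimalRange hφ (rangeSpace 𝕜 hφ) (rangeNorm hφ) ∧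
      ∀ (X : Set (ℝ → 𝕜)) (N : (ℝ → 𝕜) → ℝ≥0∞), IsOptimalRange hφ X N →
        X = rangeSpace 𝕜 hφ ∧
          Embeds X N (rangeSpace 𝕜 hφ) (rangeNorm hφ) ∧
          Embeds (rangeSpace 𝕜 hφ) (rangeNorm hφ) X N := by
  have hY := isRIQuasiBanach_rangeSpace (𝕜 := 𝕜) hφ
  have hS := hardyBounded_rangeSpace (𝕜 := 𝕜) hφ
  refine ⟨⟨hY, hS, fun X N hX hXS => rangeSpace_embeds hφ hX hXS⟩, fun X N hX => ?_⟩
  -- Two smallest spaces embed in each other, so they agree as sets with equivalent quasi-norms.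
  have h1 := hX.2.2 _ _ hY hS
  have h2 := rangeSpace_embeds hφ hX.1 hX.2.1
  exact ⟨h1.1.antisymm h2.1, h1, h2⟩
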